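/- Let $N$ be a finite set of agents partitioned into classes $N_1,\dots,N_k$, let $M$ be a finite set of items, and let $G=(N,M,E)$ be a bipartite graph; agent $a$ likes item $o$ if $(a,o)\in E$. A matching is a matrix $X\in\{0,1\}^{N\times M}$ all of whose row and column sums are at most $1$; a divisible matching is the same with entries in $[0,1]$. Agent $a$ is saturated by $X$ if $\sum_o x_{a,o}=1$, and item $o$ is assigned if $\sum_a x_{a,o}=1$. Put $$V_i(X)=\sum_{a\in N_i}\ \sum_{o:(a,o)\in E}x_{a,o},\qquad \mathrm{usw}(X)=\sum_{i}V_i(X),\qquad Y_i(X)=\Big(\sum_{a\in N_i}x_{a,o}\Big)_{o\in M}.$$ For a set of items $S$, $V_i^*(S)$ is the maximum size of a matching in $G$ between $N_i$ and $S$; for a vector $y\in[0,1]^M$, $V_i^*(y)$ is the maximum size of a fractional matching in $G$ between $N_i$ and the item amounts $y$. Let $$\mathrm{prop}_i=\max_X\min_{j}V_i^*(Y_j(X)),$$ the maximum being over all divisible matchings $X$. Let $\overline{\mathrm{prop}}_i=\max_D\min_j V_i^*(D_j)\ \ (\ge\mathrm{prop}_i)$, the maximum being over all fractional divisions $D=(D_1,\dots,D_k)$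 of the items among the classes, i.e. $D_j\in[0,1]^M$ with $\sum_jD_{j,o}\le1$ for each $o$ (no capacity constraint on the agents). The items arrive one by one, in an arbitrary fixed order. The Random algorithm starts with the empty matching. When item $o$ arrives, let $S_o$ be the set of classes that contain a currently unsaturated agent who likes $o$. If $S_o\neq\emptyset$, the algorithm picks a class $i\in S_o$ uniformly at random, then an unsaturated agent $a\in N_i$ who likes $o$ uniformly at random, and sets $x_{a,o}=1$; if $S_o=\emptyset$, the item stays unmatched. Let $X$ be the random matching obtained after all items have arrived. Theorem. For every such instance and every arrival order: 1. Every possible outcome $X$ is a matching that uses only edges of $G$ and is non-wasteful: there are no $a\in N$, $o\in M$ such that $a$ likes $o$, $a$ is not saturated and $o$ is not assigned. 2. ($\frac12$-CEF in expectation) $\mathbb E[V_i(X)]\ge\frac12\,\mathbb E[V_i^*(Y_j(X))]$ for all classes $i,j$. 3. ($\frac12$-CPROP in expectation) $\mathbb E[V_i(X)]\ge\frac12\,\mathrm{prop}_i$ for every class $i$; more strongly, $\mathbb E[V_i(X)]\ge\frac12\,\overline{\mathrm{prop}}_i$. 4. ($\frac12$-USW in expectation) $\mathbb E[\mathrm{usw}(X)]\ge\frac12\,\mathrm{usw}(Z)$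 for every matching $Z$. -/

import Mathlib

noncomputable section

namespace ClassMatching

/-- An instance of class matching with agents `N`, items `M` and `k` classes: the bipartite graph
(`likes a o` means that `(a, o)` is an edge) and the partition of the agents into classes
(`cls a` is the class of `a`, so that class `i` is `{a | cls a = i}`). -/
structure Instance (N M : Type*) (k : ℕ) where
  likes : N → M → Prop
  cls : N → Fin k

/-- A 0/1 matrix `X`, given as the set of pairs `(a, o)` with `x_{a,o} = 1`, is a matching if each
agent gets at most one item and each item goes to at most one agent. -/
def IsMatching {N M : Type*} (X : Finset (N × M)) : Prop :=
  (∀ a o o', (a, o) ∈ X → (a, o') ∈ X → o = o') ∧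
  (∀ a a' o, (a, o) ∈ X → (a', o) ∈ X → a = a')

/-- Agent `a` is saturated by the matching `X`. -/
def Saturated {N M : Type*} (X : Finset (N × M)) (a : N) : Prop :=
  ∃ o, (a, o) ∈ X

/-- Item `o` is assigned by the matching `X`. -/
def Assigned {N M : Type*} (X : Finset (N × M)) (o : M) : Prop :=
  ∃ a, (a, o) ∈ X

/-- A divisible (fractional) matching of the items to the agents. As for indivisible matchings,
an item may be given to an agent who does not like it. -/
def IsFracMatching {N M : Type*} [Fintype N] [Fintype M] (X : N → M → ℝ) : Prop :=
  (∀ a o, 0 ≤ X a o) ∧ (∀ a, ∑ o, X a o ≤ 1) ∧ (∀ o, ∑ a, X a o ≤ 1)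

/-- A fractional division of the items among `k` classes: class `j` gets the fraction `D j o` of
item `o`. -/
def IsFracDivision {M : Type*} {k : ℕ} (D : Fin k → M → ℝ) : Prop :=
  (∀ j o, 0 ≤ D j o) ∧ (∀ o, ∑ j, D j o ≤ 1)

/-- The expectation of `f` under a probability mass function on a finite type. -/
def expect {α : Type*} [Fintype α] (p : PMF α) (f : α → ℝ) : ℝ :=
  ∑ x, (p x).toReal * f x

namespace Instance

variable {N M : Type*} {k : ℕ} [Fintype N] [Fintype M] (I : Instance N M k)

open Classical in
/-- `V_i(X)`: the number of agents of class `i`, counted with the items they like, that `X`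
serves. -/
def classValue (i : Fin k) (X : Finset (N × M)) : ℕ :=
  (X.filter fun p => I.cls p.1 = i ∧ I.likes p.1 p.2).card

open Classical in
/-- The utilitarian social welfare of `X`. -/
def usw (X : Finset (N × M)) : ℕ :=
  (X.filter fun p => I.likes p.1 p.2).card

open Classical in
/-- `Y_i(X)`: the set of items that `X` matches to agents of class `i`. -/
def classItems (i : Fin k) (X : Finset (N × M)) : Finset M :=
  Finset.univ.filter fun o => ∃ a, I.cls a = i ∧ (a, o) ∈ X

open Classical in
/-- `V_i^*(S)`, the optimistic valuation: the maximum size of a matching, in the graph, between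
the agents of class `i` and the items of the set `S`. -/
def optimisticValue (i : Fin k) (S : Finset M) : ℕ :=
  ((Finset.univ : Finset (Finset (N × M))).filter fun Z =>
    IsMatching Z ∧ ∀ p ∈ Z, I.cls p.1 = i ∧ I.likes p.1 p.2 ∧ p.2 ∈ S).sup Finset.card

/-- `V_i^*(y)` for a vector `y` of nonnegative item amounts: the maximum size of a fractional
matching, in the graph, between the agents of class `i` and the amounts `y`. -/
def fracOptimisticValue (i : Fin k) (y : M → ℝ) : ℝ :=
  sSup {v | ∃ z : N → M → ℝ,
    (∀ a o, 0 ≤ z a o) ∧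
    (∀ a o, ¬ (I.cls a = i ∧ I.likes a o) → z a o = 0) ∧
    (∀ a, ∑ o, z a o ≤ 1) ∧
    (∀ o, ∑ a, z a o ≤ y o) ∧
    v = ∑ a, ∑ o, z a o}

/-- `Y_j(X)` for a divisible matching `X`: the amount of each item given to class `j`. -/
def fracClassItems (j : Fin k) (X : N → M → ℝ) : M → ℝ :=
  fun o => ∑ a, if I.cls a = j then X a o else 0

/-- The proportional share of class `i`:
`prop_i = max_X min_j V_i^*(Y_j(X))`, with `X` ranging over the divisible matchings. -/
def propShare (i : Fin k) : ℝ :=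
  sSup {v | ∃ X : N → M → ℝ, IsFracMatching X ∧
    v = ⨅ j, I.fracOptimisticValue i (I.fracClassItems j X)}

/-- The variant of the proportional share of class `i` in which the maximum is over all
fractional divisions of the items among the classes, without any capacity of the agents. -/
def divisionShare (i : Fin k) : ℝ :=
  sSup {v | ∃ D : Fin k → M → ℝ, IsFracDivision D ∧
    v = ⨅ j, I.fracOptimisticValue i (D j)}

/-- Non-wastefulness: no agent `a` and item `o` such that `a` likes `o`, `a` is not saturated and
`o` is not assigned. -/
def NonWasteful (X : Finset (N × M)) : Prop :=
  ¬ ∃ a o, I.likes a o ∧ ¬ Saturated X a ∧ ¬ Assigned X o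

/-- `α`-CEF, in expectation over a random matching with distribution `p`. -/
def ExpectedCEF (α : ℝ) (p : PMF (Finset (N × M))) : Prop :=
  ∀ i j : Fin k,
    α * expect p (fun X => (I.optimisticValue i (I.classItems j X) : ℝ)) ≤
      expect p (fun X => (I.classValue i X : ℝ))

/-- `α`-CPROP, in expectation over a random matching with distribution `p`. -/
def ExpectedCPROP (α : ℝ) (p : PMF (Finset (N × M))) : Prop :=
  ∀ i : Fin k, α * I.propShare i ≤ expect p (fun X => (I.classValue i X : ℝ))

/-- `α`-CPROP in expectation, with respect to the larger share `divisionShare`. -/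
def ExpectedDivisionCPROP (α : ℝ) (p : PMF (Finset (N × M))) : Prop :=
  ∀ i : Fin k, α * I.divisionShare i ≤ expect p (fun X => (I.classValue i X : ℝ))

/-- `α`-USW, in expectation over a random matching with distribution `p`. -/
def ExpectedUSW (α : ℝ) (p : PMF (Finset (N × M))) : Prop :=
  ∀ Z : Finset (N × M), IsMatching Z →
    α * (I.usw Z : ℝ) ≤ expect p (fun X => (I.usw X : ℝ))

open Classical in
/-- The unsaturated agents of class `i` who like the arriving item `o`. -/
def available (X : Finset (N × M)) (o : M) (i : Fin k) : Finset N :=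
  Finset.univ.filter fun a => I.cls a = i ∧ I.likes a o ∧ ¬ Saturated X a

open Classical in
/-- `S_o`: the classes with an unsaturated agent who likes the arriving item `o`. -/
def availableClasses (X : Finset (N × M)) (o : M) : Finset (Fin k) :=
  Finset.univ.filter fun i => (I.available X o i).Nonempty

open Classical in
/-- One step of the algorithm: on arrival of `o` with current matching `X`, pick a class
`i ∈ S_o` uniformly at random, then an unsaturated agent of class `i` who likes `o` uniformly at
random, and match `o` to this agent. If `S_o` is empty, `o` stays unmatched. (The inner `else`
branch is never reached, since the drawn class has an available agent.) -/
def randomStep (X : Finset (N × M)) (o : M) : PMF (Finset (N × M)) :=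
  if hS : (I.availableClasses X o).Nonempty then
    (PMF.uniformOfFinset (I.availableClasses X o) hS).bind fun i =>
      if hA : (I.available X o i).Nonempty then
        (PMF.uniformOfFinset (I.available X o i) hA).map fun a => insert (a, o) X
      else PMF.pure X
  else PMF.pure X

/-- The algorithm run on a list of arriving items, starting from the matching `X`. -/
def randomRun : List M → Finset (N × M) → PMF (Finset (N × M))
  | [], X => PMF.pure X
  | o :: os, X => (I.randomStep X o).bind fun X' => randomRun os X'

/-- The distribution of the matching that the algorithm outputs when the items arrive in the given
order. -/
def random (arrival : List M) : PMF (Finset (N × M)) :=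
  I.randomRun arrival ∅

end Instance

end ClassMatching

end

/-! Write W_i(X) for the items liked by some unsaturated agent of class i (`wanted`). The saturated
agents of class i together with the items of S ∩ W_i(X) cover every edge between class i and S.
Hence V_i^*(S) ≤ V_i(X) + |S ∩ W_i(X)| (`optimisticValue_le_add_card`), and likewise for item
amounts (`fracOptimisticValue_le`). It remains to charge the wanted items to V_i in expectation. W_i
only shrinks over time, so an item wanted at the end was wanted on arrival, and then class i
belonged to S_o.

For CEF, an item adds to |Y_j ∩ W_i| only if i ∈ S_o, and then i is drawn at least as likely as j.
So V_i - |Y_j ∩ W_i| has nonnegative drift and E|Y_j ∩ W_i| ≤ E V_i. For CPROP, each arriving wanted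
item goes to class i with probability 1/|S_o| ≥ 1/k, so E|W_i| ≤ k E V_i. Summing the cover bound
over the k bundles of a division gives k min_j V_i^*(D_j) ≤ k V_i + |W_i|. USW holds outcome by
outcome, by non-wastefulness. -/

namespace ClassMatching

/-! ### Expectations over a finite type. -/

section Expect

variable {α β : Type*} [Fintype α] [Fintype β]

theorem sum_toReal_eq_one (p : PMF α) : ∑ x, (p x).toReal = 1 := by
  have h := p.tsum_coe
  rw [tsum_fintype] at h
  rw [← ENNReal.toReal_sum fun x _ => p.apply_ne_top x, h, ENNReal.toReal_one]

theorem expect_const (p : PMF α) (c : ℝ) : expect p (fun _ => c) = c := by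
  rw [expect, ← Finset.sum_mul, sum_toReal_eq_one, one_mul]

theorem expect_mono {p : PMF α} {f g : α → ℝ} (h : ∀ x ∈ p.support, f x ≤ g x) :
    expect p f ≤ expect p g := by
  refine Finset.sum_le_sum fun x _ => ?_
  by_cases hx : x ∈ p.support
  · exact mul_le_mul_of_nonneg_left (h x hx) ENNReal.toReal_nonneg
  · simp [(p.apply_eq_zero_iff x).2 hx]

theorem expect_add (p : PMF α) (f g : α → ℝ) :
    expect p (fun x => f x + g x) = expect p f + expect p g := by
  simp only [expect, mul_add, Finset.sum_add_distrib]

theorem expect_sub (p : PMF α) (f g : α → ℝ) :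
    expect p (fun x => f x - g x) = expect p f - expect p g := by
  simp only [expect, mul_sub, Finset.sum_sub_distrib]

theorem expect_const_mul (p : PMF α) (c : ℝ) (f : α → ℝ) :
    expect p (fun x => c * f x) = c * expect p f := by
  simp only [expect, Finset.mul_sum]
  exact Finset.sum_congr rfl fun x _ => by ring

theorem expect_pure (x : α) (f : α → ℝ) : expect (PMF.pure x) f = f x := by
  classical
  rw [expect, Finset.sum_eq_single x]
  · simp
  · intro y _ hy
    simp [PMF.pure_apply, hy]
  · simp

theorem expect_bind (p : PMF α) (q : α → PMF β) (f : β → ℝ) :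
    expect (p.bind q) f = expect p fun x => expect (q x) f := by
  have h : ∀ y, ((p.bind q) y).toReal = ∑ x, (p x).toReal * (q x y).toReal := by
    intro y
    rw [PMF.bind_apply, tsum_fintype, ENNReal.toReal_sum]
    · simp [ENNReal.toReal_mul]
    · exact fun x _ => ENNReal.mul_ne_top (p.apply_ne_top x) ((q x).apply_ne_top y)
  simp only [expect, h, Finset.sum_mul, Finset.mul_sum]
  rw [Finset.sum_comm]
  exact Finset.sum_congr rfl fun x _ => Finset.sum_congr rfl fun y _ => by ring

theorem expect_uniformOfFinset (s : Finset α) (hs : s.Nonempty) (f : α → ℝ) :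
    expect (PMF.uniformOfFinset s hs) f = (∑ x ∈ s, f x) / s.card := by
  classical
  have h : ∀ x, ((PMF.uniformOfFinset s hs) x).toReal * f x =
      if x ∈ s then f x / s.card else 0 := by
    intro x
    rw [PMF.uniformOfFinset_apply]
    split_ifs
    · rw [ENNReal.toReal_inv, ENNReal.toReal_natCast, inv_mul_eq_div]
    · simp
  rw [expect, Finset.sum_congr rfl fun x _ => h x, Finset.sum_ite_mem, Finset.univ_inter,
    Finset.sum_div]

end Expect

theorem Saturated.mono {N M : Type*} {X X' : Finset (N × M)} (h : X ⊆ X') {a : N}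
    (ha : Saturated X a) : Saturated X' a :=
  ha.imp fun _ ho => h ho

namespace Instance

variable {N M : Type*} {k : ℕ} [Fintype N] [Fintype M] (I : Instance N M k)

/-! ### Single steps and runs of the algorithm. -/

theorem mem_available {X : Finset (N × M)} {o : M} {i : Fin k} {a : N} :
    a ∈ I.available X o i ↔ I.cls a = i ∧ I.likes a o ∧ ¬ Saturated X a := by
  simp [available]

theorem mem_availableClasses {X : Finset (N × M)} {o : M} {i : Fin k} :
    i ∈ I.availableClasses X o ↔ ∃ a, I.cls a = i ∧ I.likes a o ∧ ¬ Saturated X a := by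
  rw [availableClasses, Finset.mem_filter]
  simp [Finset.Nonempty, mem_available]

open Classical in
theorem mem_support_randomStep {X X' : Finset (N × M)} {o : M}
    (h : X' ∈ (I.randomStep X o).support) :
    (X' = X ∧ ∀ a, I.likes a o → Saturated X a) ∨
      ∃ a, I.likes a o ∧ ¬ Saturated X a ∧ X' = insert (a, o) X := by
  rw [randomStep] at h
  split_ifs at h with hS
  · right
    rw [PMF.mem_support_bind_iff] at h
    obtain ⟨i, hi, h⟩ := h
    have hA : (I.available X o i).Nonempty := by
      simpa [availableClasses] using hi
    rw [dif_pos hA, PMF.mem_support_map_iff] at h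
    obtain ⟨a, ha, rfl⟩ := h
    rw [PMF.mem_support_uniformOfFinset_iff, mem_available] at ha
    exact ⟨a, ha.2.1, ha.2.2, rfl⟩
  · left
    refine ⟨by simpa using h, fun a ha => ?_⟩
    by_contra hsat
    exact hS ⟨I.cls a, I.mem_availableClasses.2 ⟨a, rfl, ha, hsat⟩⟩

open Classical in
/-- If giving the item to any available agent of class `i` yields at least `g i`, the expected
value of a step is at least the average of `g` over the available classes. -/
theorem average_le_expect_randomStep {X : Finset (N × M)} {o : M}
    (hS : (I.availableClasses X o).Nonempty) {f : Finset (N × M) → ℝ} {g : Fin k → ℝ}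
    (h : ∀ a, I.likes a o → ¬ Saturated X a → g (I.cls a) ≤ f (insert (a, o) X)) :
    (∑ i ∈ I.availableClasses X o, g i) / (I.availableClasses X o).card ≤
      expect (I.randomStep X o) f := by
  rw [randomStep, dif_pos hS, expect_bind, expect_uniformOfFinset]
  gcongr with i hi
  have hA : (I.available X o i).Nonempty := by
    simpa [availableClasses] using hi
  rw [dif_pos hA, ← expect_const ((PMF.uniformOfFinset (I.available X o i) hA).map
    fun a => insert (a, o) X) (g i)]
  refine expect_mono fun X' hX' => ?_
  obtain ⟨a, ha, rfl⟩ := (PMF.mem_support_map_iff _ _ _).1 hX'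
  rw [PMF.mem_support_uniformOfFinset_iff, mem_available] at ha
  obtain ⟨rfl, hl, hs⟩ := ha
  exact h a hl hs

/-- A time-dependent potential that does not decrease in expectation in any step does not decrease
in expectation over the whole run. -/
theorem le_expect_randomRun {Φ : List M → Finset (N × M) → ℝ}
    (hΦ : ∀ o os X, Φ (o :: os) X ≤ expect (I.randomStep X o) (Φ os))
    (os : List M) (X : Finset (N × M)) :
    Φ os X ≤ expect (I.randomRun os X) (Φ []) := by
  induction os generalizing X with
  | nil => rw [randomRun, expect_pure]
  | cons o os ih =>
    rw [randomRun, expect_bind]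
    exact (hΦ o os X).trans (expect_mono fun X' _ => ih X')

theorem randomRun_support_induction {P : List M → Finset (N × M) → Prop}
    (hP : ∀ o os X, P (o :: os) X → ∀ X' ∈ (I.randomStep X o).support, P os X')
    {os : List M} {X : Finset (N × M)} (h : P os X) {X' : Finset (N × M)}
    (hX' : X' ∈ (I.randomRun os X).support) : P [] X' := by
  induction os generalizing X with
  | nil =>
    rw [randomRun, PMF.mem_support_pure_iff] at hX'
    exact hX' ▸ h
  | cons o os ih =>
    rw [randomRun, PMF.mem_support_bind_iff] at hX'
    obtain ⟨Y, hY, hX'⟩ := hX'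
    exact ih (hP o os X h Y hY) hX'

theorem random_support {arrival : List M} (hnodup : arrival.Nodup) (hall : ∀ o, o ∈ arrival)
    {X : Finset (N × M)} (hX : X ∈ (I.random arrival).support) :
    IsMatching X ∧ (∀ p ∈ X, I.likes p.1 p.2) ∧ I.NonWasteful X := by
  classical
  -- The list holds the items still to come. They are all unassigned, which keeps the matching
  -- property at the next step; non-wastefulness is required only for items off the list, hence
  -- vacuous at the start.
  let P : List M → Finset (N × M) → Prop := fun os X =>
    os.Nodup ∧ IsMatching X ∧ (∀ p ∈ X, I.likes p.1 p.2) ∧ (∀ o ∈ os, ¬ Assigned X o) ∧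
      ∀ a o, o ∉ os → I.likes a o → Saturated X a ∨ Assigned X o
  have hstart : P arrival ∅ :=
    ⟨hnodup, by simp [IsMatching], by simp, by simp [Assigned],
      fun a o ho => absurd (hall o) ho⟩
  suffices hP : ∀ o os X, P (o :: os) X → ∀ X' ∈ (I.randomStep X o).support, P os X' by
    obtain ⟨-, h1, h2, -, h3⟩ := I.randomRun_support_induction hP hstart hX
    exact ⟨h1, h2, fun ⟨a, o, hl, hs, ho⟩ => (h3 a o (by simp) hl).elim hs ho⟩
  rintro o os X ⟨hnd, ⟨hm1, hm2⟩, hedge, hfree, hnw⟩ X' hX'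
  rw [List.nodup_cons] at hnd
  have hfreeo : ∀ a, (a, o) ∉ X := fun a ha => hfree o (by simp) ⟨a, ha⟩
  obtain ⟨rfl, hsat⟩ | ⟨a, hl, hs, rfl⟩ := I.mem_support_randomStep hX'
  · refine ⟨hnd.2, ⟨hm1, hm2⟩, hedge, fun o' ho' => hfree o' (by simp [ho']), fun b o' ho' hb => ?_⟩
    by_cases h : o' = o
    · subst h
      exact Or.inl (hsat b hb)
    · exact hnw b o' (by simp [h, ho']) hb
  · have hsa : ∀ o', (a, o') ∉ X := fun o' h => hs ⟨o', h⟩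
    refine ⟨hnd.2, ⟨?_, ?_⟩, ?_, ?_, ?_⟩
    · intro b o₁ o₂ h₁ h₂
      simp only [Finset.mem_insert, Prod.mk.injEq] at h₁ h₂
      grind
    · intro b₁ b₂ o' h₁ h₂
      simp only [Finset.mem_insert, Prod.mk.injEq] at h₁ h₂
      grind
    · intro p hp
      obtain rfl | hp := Finset.mem_insert.1 hp
      · exact hl
      · exact hedge p hp
    · rintro o' ho' ⟨b, hb⟩
      obtain hb | hb := Finset.mem_insert.1 hb
      · obtain ⟨-, rfl⟩ := Prod.mk.inj hb
        exact hnd.1 ho'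
      · exact hfree o' (by simp [ho']) ⟨b, hb⟩
    · intro b o' ho' hb
      by_cases h : o' = o
      · subst h
        exact Or.inr ⟨a, by simp⟩
      · exact (hnw b o' (by simp [h, ho']) hb).imp (Saturated.mono (Finset.subset_insert _ _))
          fun ⟨c, hc⟩ => ⟨c, Finset.mem_insert_of_mem hc⟩

/-! ### Wanted items and the cover bound. -/

open Classical in
theorem classValue_insert {X : Finset (N × M)} {a : N} {o : M} (hl : I.likes a o)
    (hs : ¬ Saturated X a) (i : Fin k) :
    I.classValue i (insert (a, o) X) = I.classValue i X + if I.cls a = i then 1 else 0 := by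
  have hX : (a, o) ∉ X := fun h => hs ⟨o, h⟩
  rw [classValue, classValue, Finset.filter_insert]
  by_cases h : I.cls a = i
  · rw [if_pos ⟨h, hl⟩, if_pos h, Finset.card_insert_of_notMem (by simp [hX])]
  · rw [if_neg fun h' => h h'.1, if_neg h, add_zero]

open Classical in
/-- The items liked by an agent of class `i` that `X` does not saturate. -/
noncomputable def wanted (i : Fin k) (X : Finset (N × M)) : Finset M :=
  Finset.univ.filter fun o => i ∈ I.availableClasses X o

theorem mem_wanted {i : Fin k} {X : Finset (N × M)} {o : M} :
    o ∈ I.wanted i X ↔ i ∈ I.availableClasses X o := by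
  simp [wanted]

theorem wanted_anti (i : Fin k) {X X' : Finset (N × M)} (h : X ⊆ X') :
    I.wanted i X' ⊆ I.wanted i X := by
  intro o
  simp only [mem_wanted, mem_availableClasses]
  exact fun ⟨a, h1, h2, h3⟩ => ⟨a, h1, h2, fun hs => h3 (hs.mono h)⟩

open Classical in
/-- The number of agents of class `i` saturated by `X` is at most `V_i(X)`. -/
theorem card_saturated_le (i : Fin k) {X : Finset (N × M)} (hX : ∀ p ∈ X, I.likes p.1 p.2) :
    (Finset.univ.filter fun a => I.cls a = i ∧ Saturated X a).card ≤ I.classValue i X := by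
  refine (Finset.card_le_card (t := (X.filter fun p =>
    I.cls p.1 = i ∧ I.likes p.1 p.2).image Prod.fst) ?_).trans Finset.card_image_le
  intro a ha
  obtain ⟨hc, o, ho⟩ := (Finset.mem_filter.1 ha).2
  exact Finset.mem_image.2 ⟨(a, o), Finset.mem_filter.2 ⟨ho, hc, hX _ ho⟩, rfl⟩

-- Split a matching `Z` by whether its agent is saturated in `X`: the first kind injects into
-- saturated agents, the second into wanted items of `S`.
open Classical in
theorem optimisticValue_le_add_card (i : Fin k) (S : Finset M) {X : Finset (N × M)}
    (hX : ∀ p ∈ X, I.likes p.1 p.2) :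
    I.optimisticValue i S ≤ I.classValue i X + (S ∩ I.wanted i X).card := by
  refine Finset.sup_le fun Z hZ => ?_
  obtain ⟨⟨hm1, hm2⟩, hZ⟩ := (Finset.mem_filter.1 hZ).2
  rw [← Finset.card_filter_add_card_filter_not (s := Z) fun p => Saturated X p.1]
  refine add_le_add ((Finset.card_le_card_of_injOn Prod.fst ?_ ?_).trans
    (I.card_saturated_le i hX)) (Finset.card_le_card_of_injOn Prod.snd ?_ ?_)
  · intro p hp
    obtain ⟨hp, hs⟩ := Finset.mem_filter.1 hp
    simpa using ⟨(hZ p hp).1, hs⟩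
  · rintro ⟨a, o⟩ hp ⟨a', o'⟩ hp' (rfl : a = a')
    rw [hm1 a o o' (Finset.mem_filter.1 hp).1 (Finset.mem_filter.1 hp').1]
  · intro p hp
    obtain ⟨hp, hs⟩ := Finset.mem_filter.1 hp
    obtain ⟨h1, h2, h3⟩ := hZ p hp
    exact Finset.mem_coe.2 (Finset.mem_inter.2
      ⟨h3, I.mem_wanted.2 (I.mem_availableClasses.2 ⟨p.1, h1, h2, hs⟩)⟩)
  · rintro ⟨a, o⟩ hp ⟨a', o'⟩ hp' (rfl : o = o')
    rw [hm2 a a' o (Finset.mem_filter.1 hp).1 (Finset.mem_filter.1 hp').1]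

/-! ### Class envy-freeness. -/

open Classical in
theorem classItems_insert_subset (j : Fin k) (X : Finset (N × M)) (a : N) (o : M) :
    I.classItems j (insert (a, o) X) ⊆
      if I.cls a = j then insert o (I.classItems j X) else I.classItems j X := by
  intro o' ho'
  obtain ⟨b, hc, hb⟩ := (Finset.mem_filter.1 ho').2
  obtain hb | hb := Finset.mem_insert.1 hb
  · obtain ⟨rfl, rfl⟩ := Prod.mk.inj hb
    simp [hc]
  · have : o' ∈ I.classItems j X := by
      simpa [classItems] using ⟨b, hc, hb⟩
    split_ifs <;> simp [this]

open Classical in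
/-- The items of class `j` that are wanted by class `i`: at most the arriving item is new. -/
theorem card_classItems_inter_wanted_insert_le (i j : Fin k) (X : Finset (N × M)) (a : N) (o : M) :
    (I.classItems j (insert (a, o) X) ∩ I.wanted i (insert (a, o) X)).card ≤
      (I.classItems j X ∩ I.wanted i X).card +
        if I.cls a = j ∧ i ∈ I.availableClasses X o then 1 else 0 := by
  have hsub := Finset.inter_subset_inter (I.classItems_insert_subset j X a o)
    (I.wanted_anti i (Finset.subset_insert (a, o) X))
  refine (Finset.card_le_card hsub).trans ?_
  by_cases hj : I.cls a = j
  · by_cases hi : i ∈ I.availableClasses X o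
    · rw [if_pos hj, if_pos ⟨hj, hi⟩, Finset.insert_inter_of_mem (I.mem_wanted.2 hi)]
      exact Finset.card_insert_le _ _
    · rw [if_pos hj, if_neg fun h => hi h.2,
        Finset.insert_inter_of_notMem fun h => hi (I.mem_wanted.1 h), add_zero]
  · rw [if_neg hj, if_neg fun h => hj h.1, add_zero]

-- The difference of the two sides is a potential that starts at 0 and has nonnegative drift.
open Classical in
theorem expect_classItems_inter_wanted_le (arrival : List M) (i j : Fin k) :
    expect (I.random arrival) (fun X => ((I.classItems j X ∩ I.wanted i X).card : ℝ)) ≤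
      expect (I.random arrival) (fun X => (I.classValue i X : ℝ)) := by
  let Φ : List M → Finset (N × M) → ℝ := fun _ X =>
    (I.classValue i X : ℝ) - ((I.classItems j X ∩ I.wanted i X).card : ℝ)
  have key := I.le_expect_randomRun (Φ := Φ) ?_ arrival ∅
  · rw [← sub_nonneg, ← expect_sub]
    refine le_trans (le_of_eq ?_) key
    simp [Φ, classValue, classItems]
  intro o os X
  by_cases hS : (I.availableClasses X o).Nonempty
  · let g : Fin k → ℝ := fun l => Φ [] X + ((if l = i then 1 else 0) -
      if l = j ∧ i ∈ I.availableClasses X o then 1 else 0)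
    refine le_trans ?_ (I.average_le_expect_randomStep hS (g := g) ?_)
    · rw [le_div_iff₀ (by exact_mod_cast hS.card_pos), Finset.sum_add_distrib,
        Finset.sum_const, nsmul_eq_mul, Finset.sum_sub_distrib, Finset.sum_ite_eq']
      -- If i is available, the draw l = i contributes a gain of 1 to the sum; the loss comes from
      -- the single draw l = j, if at all.
      have h : (∑ l ∈ I.availableClasses X o,
          if l = j ∧ i ∈ I.availableClasses X o then (1 : ℝ) else 0) ≤
          if i ∈ I.availableClasses X o then 1 else 0 := by
        split_ifs with hi
        · simp only [hi, and_true, Finset.sum_ite_eq']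
          split_ifs <;> norm_num
        · simp [hi]
      change Φ [] X * _ ≤ _
      linarith
    · intro a hl hs
      have h := I.card_classItems_inter_wanted_insert_le i j X a o
      have h' : ((I.classItems j (insert (a, o) X) ∩ I.wanted i (insert (a, o) X)).card : ℝ) ≤
          (I.classItems j X ∩ I.wanted i X).card +
            if I.cls a = j ∧ i ∈ I.availableClasses X o then 1 else 0 := by
        exact_mod_cast h
      simp only [g, Φ, I.classValue_insert hl hs]
      push_cast
      linarith
  · rw [randomStep, dif_neg hS, expect_pure]

theorem expectedCEF_random {arrival : List M} (hnodup : arrival.Nodup)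
    (hall : ∀ o, o ∈ arrival) : I.ExpectedCEF (1 / 2) (I.random arrival) := by
  classical
  intro i j
  have h : expect (I.random arrival)
      (fun X => (I.optimisticValue i (I.classItems j X) : ℝ)) ≤
      expect (I.random arrival) (fun X => (I.classValue i X : ℝ) +
        ((I.classItems j X ∩ I.wanted i X).card : ℝ)) :=
    expect_mono fun X hX => by
      exact_mod_cast I.optimisticValue_le_add_card i _ (I.random_support hnodup hall hX).2.1
  rw [expect_add] at h
  have := I.expect_classItems_inter_wanted_le arrival i j
  linarith

/-! ### Proportionality. -/

theorem fracOptimisticValue_le (i : Fin k) {y : M → ℝ} (hy : ∀ o, 0 ≤ y o) {X : Finset (N × M)}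
    (hX : ∀ p ∈ X, I.likes p.1 p.2) :
    I.fracOptimisticValue i y ≤ I.classValue i X + ∑ o ∈ I.wanted i X, y o := by
  classical
  -- The bound must be nonnegative because the supremum of the empty set is 0 in ℝ.
  refine Real.sSup_le ?_ (add_nonneg (Nat.cast_nonneg _) (Finset.sum_nonneg fun o _ => hy o))
  rintro v ⟨z, hz0, hzE, hza, hzo, rfl⟩
  -- A saturated agent of class i has total weight at most 1; any other agent puts weight only on
  -- wanted items.
  have hpt : ∀ a, ∑ o, z a o ≤ (if I.cls a = i ∧ Saturated X a then 1 else 0) +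
      ∑ o ∈ I.wanted i X, z a o := by
    intro a
    by_cases ha : I.cls a = i ∧ Saturated X a
    · rw [if_pos ha]
      exact le_add_of_le_of_nonneg (hza a) (Finset.sum_nonneg fun o _ => hz0 a o)
    · rw [if_neg ha, zero_add]
      refine le_of_eq (Finset.sum_subset (Finset.subset_univ _) fun o _ ho => ?_).symm
      exact hzE a o fun h => ho (I.mem_wanted.2 (I.mem_availableClasses.2
        ⟨a, h.1, h.2, fun hs => ha ⟨h.1, hs⟩⟩))
  refine (Finset.sum_le_sum fun a _ => hpt a).trans ?_
  rw [Finset.sum_add_distrib, Finset.sum_comm (s := Finset.univ)]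
  refine add_le_add ?_ (Finset.sum_le_sum fun o _ => hzo o)
  rw [Finset.sum_boole]
  exact_mod_cast I.card_saturated_le i hX

-- The potential counts only wanted items that have already arrived. An item can enter this count
-- only on arrival, at a cost of 1, while the gain k is won with probability 1/|S_o| ≥ 1/k.
open Classical in
theorem expect_card_wanted_le {arrival : List M} (hall : ∀ o, o ∈ arrival) (i : Fin k) :
    expect (I.random arrival) (fun X => ((I.wanted i X).card : ℝ)) ≤
      k * expect (I.random arrival) (fun X => (I.classValue i X : ℝ)) := by
  let Φ : List M → Finset (N × M) → ℝ := fun os X =>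
    k * (I.classValue i X : ℝ) - ((I.wanted i X \ os.toFinset).card : ℝ)
  have key := I.le_expect_randomRun (Φ := Φ) ?_ arrival ∅
  · rw [← sub_nonneg, ← expect_const_mul, ← expect_sub]
    have h0 : Φ arrival ∅ = 0 := by
      have : I.wanted i (∅ : Finset (N × M)) \ arrival.toFinset = ∅ := by
        simp [Finset.sdiff_eq_empty_iff_subset, Finset.subset_iff, hall]
      simp [Φ, classValue, this]
    rw [h0] at key
    simpa [Φ, random] using key
  intro o os X
  have hcard : ∀ X', X ⊆ X' → ((I.wanted i X' \ os.toFinset).card : ℝ) ≤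
      (I.wanted i X \ (o :: os).toFinset).card +
        if i ∈ I.availableClasses X o then 1 else 0 := by
    intro X' hX'
    have hsub : I.wanted i X' \ os.toFinset ⊆ (I.wanted i X \ (o :: os).toFinset) ∪
        if i ∈ I.availableClasses X o then {o} else ∅ := by
      intro o' ho'
      obtain ⟨h1, h2⟩ := Finset.mem_sdiff.1 ho'
      have h3 := I.wanted_anti i hX' h1
      by_cases h : o' = o
      · subst h
        simp [I.mem_wanted.1 h3]
      · refine Finset.mem_union_left _ (Finset.mem_sdiff.2 ⟨h3, ?_⟩)
        simpa [h] using h2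
    have := (Finset.card_le_card hsub).trans (Finset.card_union_le _ _)
    refine (Nat.cast_le.2 this).trans (le_of_eq ?_)
    push_cast
    split_ifs <;> simp
  by_cases hS : (I.availableClasses X o).Nonempty
  · let g : Fin k → ℝ := fun l => Φ (o :: os) X + ((k * if l = i then 1 else 0) -
      if i ∈ I.availableClasses X o then 1 else 0)
    refine le_trans ?_ (I.average_le_expect_randomStep hS (g := g) ?_)
    · rw [le_div_iff₀ (by exact_mod_cast hS.card_pos), Finset.sum_add_distrib,
        Finset.sum_const, nsmul_eq_mul, Finset.sum_sub_distrib, ← Finset.mul_sum,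
        Finset.sum_ite_eq', Finset.sum_const, nsmul_eq_mul]
      have hle : ((I.availableClasses X o).card : ℝ) ≤ k := by
        exact_mod_cast (Finset.card_le_univ _).trans_eq (Fintype.card_fin k)
      split_ifs <;> linarith
    · intro a hl hs
      have h := hcard _ (Finset.subset_insert (a, o) X)
      simp only [g, Φ, I.classValue_insert hl hs]
      push_cast
      linarith
  · rw [randomStep, dif_neg hS, expect_pure]
    have h := hcard X subset_rfl
    rw [if_neg fun h => hS ⟨i, h⟩] at h
    simp only [Φ]
    linarith

/-- For every fractional division, the value that class `i` can guarantee itself is at most twice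
its expected value. -/
theorem iInf_fracOptimisticValue_le {arrival : List M} (hnodup : arrival.Nodup)
    (hall : ∀ o, o ∈ arrival) (i : Fin k) {D : Fin k → M → ℝ} (hD : IsFracDivision D) :
    ⨅ j, I.fracOptimisticValue i (D j) ≤
      2 * expect (I.random arrival) (fun X => (I.classValue i X : ℝ)) := by
  have hk : (0 : ℝ) < k := by exact_mod_cast i.pos
  have hpt : ∀ X ∈ (I.random arrival).support, k * ⨅ j, I.fracOptimisticValue i (D j) ≤
      k * (I.classValue i X : ℝ) + ((I.wanted i X).card : ℝ) := by
    intro X hX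
    have hedge := (I.random_support hnodup hall hX).2.1
    -- The minimum is at most the average over the k bundles, and the bundles together contain each
    -- wanted item at most once.
    calc k * ⨅ j, I.fracOptimisticValue i (D j)
        = ∑ _l : Fin k, ⨅ j, I.fracOptimisticValue i (D j) := by simp
      _ ≤ ∑ l, I.fracOptimisticValue i (D l) :=
          Finset.sum_le_sum fun l _ => ciInf_le (Set.finite_range _).bddBelow l
      _ ≤ ∑ l, ((I.classValue i X : ℝ) + ∑ o ∈ I.wanted i X, D l o) :=
          Finset.sum_le_sum fun l _ => I.fracOptimisticValue_le i (hD.1 l) hedge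
      _ = k * (I.classValue i X : ℝ) + ∑ o ∈ I.wanted i X, ∑ l, D l o := by
          rw [Finset.sum_add_distrib, Finset.sum_comm]
          simp
      _ ≤ k * (I.classValue i X : ℝ) + ((I.wanted i X).card : ℝ) := by
          gcongr
          refine (Finset.sum_le_sum fun o _ => hD.2 o).trans_eq ?_
          simp
  have h := expect_mono hpt
  rw [expect_const, expect_add, expect_const_mul] at h
  have h' := I.expect_card_wanted_le hall i
  refine le_of_mul_le_mul_left ?_ hk
  linarith

theorem expect_classValue_nonneg (p : PMF (Finset (N × M))) (i : Fin k) :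
    0 ≤ expect p (fun X => (I.classValue i X : ℝ)) := by
  rw [← expect_const p 0]
  exact expect_mono fun X _ => Nat.cast_nonneg _

theorem expectedDivisionCPROP_random {arrival : List M} (hnodup : arrival.Nodup)
    (hall : ∀ o, o ∈ arrival) : I.ExpectedDivisionCPROP (1 / 2) (I.random arrival) := by
  intro i
  have h : I.divisionShare i ≤
      2 * expect (I.random arrival) (fun X => (I.classValue i X : ℝ)) := by
    refine Real.sSup_le ?_ (mul_nonneg zero_le_two (I.expect_classValue_nonneg _ i))
    rintro v ⟨D, hD, rfl⟩
    exact I.iInf_fracOptimisticValue_le hnodup hall i hD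
  linarith

/-- Lets the bound for divisions apply to every divisible matching, so that `propShare` needs no
separate argument. -/
theorem isFracDivision_fracClassItems {X : N → M → ℝ} (hX : IsFracMatching X) :
    IsFracDivision fun j => I.fracClassItems j X := by
  refine ⟨fun j o => Finset.sum_nonneg fun a _ => ?_, fun o => ?_⟩
  · split_ifs
    exacts [hX.1 a o, le_rfl]
  · simp only [fracClassItems]
    rw [Finset.sum_comm]
    simpa using hX.2.2 o

theorem expectedCPROP_random {arrival : List M} (hnodup : arrival.Nodup)
    (hall : ∀ o, o ∈ arrival) : I.ExpectedCPROP (1 / 2) (I.random arrival) := by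
  intro i
  have h : I.propShare i ≤
      2 * expect (I.random arrival) (fun X => (I.classValue i X : ℝ)) := by
    refine Real.sSup_le ?_ (mul_nonneg zero_le_two (I.expect_classValue_nonneg _ i))
    rintro v ⟨X, hX, rfl⟩
    exact I.iInf_fracOptimisticValue_le hnodup hall i (I.isFracDivision_fracClassItems hX)
  linarith

/-! ### Utilitarian welfare. -/

/-- A non-wasteful matching has at least half of the welfare of any matching. -/
theorem usw_le_two_mul_usw {X Z : Finset (N × M)} (hedge : ∀ p ∈ X, I.likes p.1 p.2)
    (hnw : I.NonWasteful X) (hZ : IsMatching Z) : I.usw Z ≤ 2 * I.usw X := by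
  classical
  have hX : I.usw X = X.card := by
    rw [usw, Finset.filter_true_of_mem hedge]
  -- Liked pairs of `Z` with a saturated agent inject into the agents of `X`; for the others,
  -- non-wastefulness makes the item assigned, so they inject into the items of `X`.
  rw [hX, two_mul, usw, ← Finset.card_filter_add_card_filter_not fun p => Saturated X p.1]
  refine add_le_add ((Finset.card_le_card_of_injOn (t := X.image Prod.fst) Prod.fst ?_ ?_).trans
    Finset.card_image_le) ((Finset.card_le_card_of_injOn (t := X.image Prod.snd) Prod.snd
    ?_ ?_).trans Finset.card_image_le)
  · intro p hp
    obtain ⟨o, ho⟩ := (Finset.mem_filter.1 hp).2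
    exact Finset.mem_coe.2 (Finset.mem_image.2 ⟨_, ho, rfl⟩)
  · rintro ⟨a, o⟩ hp ⟨a', o'⟩ hp' (rfl : a = a')
    simp only [Finset.coe_filter, Finset.mem_filter, Set.mem_ofPred_eq] at hp hp'
    rw [hZ.1 a o o' hp.1.1 hp'.1.1]
  · intro p hp
    obtain ⟨hp, hs⟩ := Finset.mem_filter.1 hp
    have : Assigned X p.2 := by
      by_contra h
      exact hnw ⟨p.1, p.2, (Finset.mem_filter.1 hp).2, hs, h⟩
    obtain ⟨a, ha⟩ := this
    exact Finset.mem_coe.2 (Finset.mem_image.2 ⟨_, ha, rfl⟩)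
  · rintro ⟨a, o⟩ hp ⟨a', o'⟩ hp' (rfl : o = o')
    simp only [Finset.coe_filter, Finset.mem_filter, Set.mem_ofPred_eq] at hp hp'
    rw [hZ.2 a a' o hp.1.1 hp'.1.1]

theorem expectedUSW_random {arrival : List M} (hnodup : arrival.Nodup)
    (hall : ∀ o, o ∈ arrival) : I.ExpectedUSW (1 / 2) (I.random arrival) := by
  intro Z hZ
  rw [← expect_const (I.random arrival) (1 / 2 * (I.usw Z : ℝ))]
  refine expect_mono fun X hX => ?_
  obtain ⟨-, hedge, hnw⟩ := I.random_support hnodup hall hX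
  have h : (I.usw Z : ℝ) ≤ 2 * I.usw X := by
    exact_mod_cast I.usw_le_two_mul_usw hedge hnw hZ
  linarith

end Instance

end ClassMatching

theorem theorem1 {N M : Type*} [Fintype N] [Fintype M] {k : ℕ}
    (I : ClassMatching.Instance N M k)
    (arrival : List M) (hnodup : arrival.Nodup) (hall : ∀ o, o ∈ arrival) :
    (∀ X ∈ (I.random arrival).support,
      ClassMatching.IsMatching X ∧ (∀ p ∈ X, I.likes p.1 p.2) ∧ I.NonWasteful X) ∧
    I.ExpectedCEF (1 / 2) (I.random arrival) ∧
    I.ExpectedCPROP (1 / 2) (I.random arrival) ∧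
    I.ExpectedDivisionCPROP (1 / 2) (I.random arrival) ∧
    I.ExpectedUSW (1 / 2) (I.random arrival) := by
  exact ⟨fun X hX => I.random_support hnodup hall hX, I.expectedCEF_random hnodup hall,
    I.expectedCPROP_random hnodup hall, I.expectedDivisionCPROP_random hnodup hall,
    I.expectedUSW_random hnodup hall⟩
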